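/- Let $K=\mathbf C((x))$, let $\overline K=\bigcup_{d\ge 1}\mathbf C[[x^{1/d}]][1/x]$ be the field of Puiseux series, and let $\nu:\overline K\to\mathbf Q\cup\{+\infty\}$ be its $x$-adic valuation. Let $f\in\mathbf C[[x]][y]$ be a distinguished polynomial of degree $n\ge 2$ in $y$ (that is, $f$ is monic in $y$ and $f(0,y)=y^n$), not necessarily reduced. Let $a_1,\dots,a_N\in\overline K$ be the pairwise distinct roots of $f$ (so $f=\prod_{i=1}^N(y-a_i)^{\mu_i}$ with $\mu_i\ge1$ and $\sum_i\mu_i=n$), and put $\varepsilon_i=\prod_{j\ne i}(y-a_j)$ for $1\le i\le N$. Let $\mathcal E\subset K[y]$ be the space of polynomials of degree $<N$ in $y$, and let $\mathcal F\subset\mathcal E$ be the subspace of polynomials of degree $<N-1$ (so $\mathcal F=0$ if $N=1$). For $r\in\mathbf Q$, put $$\mathcal E_r=\Big\{\sum_{i=1}^N u_i\varepsilon_i\in\mathcal E\ :\ u_i\in\overline K,\ \nu(u_i)\ge r\ (1\le i\le N)\Big\},\qquad \mathcal F_r=\mathcal E_r\cap\mathcal F,$$ $$\mathcal E_{>r}=\Big\{\sum_{i=1}^N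 u_i\varepsilon_i\in\mathcal E\ :\ u_i\in\overline K,\ \nu(u_i)> r\ (1\le i\le N)\Big\}.$$ Let $d$ be the least common multiple of the degrees in $y$ of the irreducible factors of $f$ in $\mathbf C[[x]][y]$. Then for every $r\in\frac1d\mathbf Z$, $$\mathcal F_r\,f\ \subset\ \mathcal F_{r+1}\,f'_x+\mathcal E_{>r}\,f'_y ,$$ that is, for every $w\in\mathcal F_r$ there are $u\in\mathcal F_{r+1}$ and $v\in\mathcal E_{>r}$ with $wf=uf'_x+vf'_y$, where $f'_x$ and $f'_y$ are the partial derivatives of $f$. -/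

import Mathlib

open Polynomial PowerSeries

namespace PlaneBranches

/-- The ring embedding `ℂ((t)) → ℂ((x^ℚ))`, `t ↦ x^(1/d)`. Its image is the field
`ℂ[[x^(1/d)]][1/x]`. -/
noncomputable def ramify (d : ℕ+) : LaurentSeries ℂ →+* HahnSeries ℚ ℂ :=
  HahnSeries.embDomainRingHom
    ((AddMonoidHom.mulRight ((d : ℚ)⁻¹)).comp (Int.castAddHom ℚ))
    (by
      intro a b h
      have hd : ((d : ℚ)⁻¹) ≠ 0 := by simp
      simpa [hd] using h)
    (by
      intro a b
      have hd : (0 : ℚ) < (d : ℚ)⁻¹ := by simp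
      simp [mul_le_mul_iff_left₀ hd])

/-- The coefficient of `x^(k/d)` in `ramify d a` is the coefficient of `t^k` in `a`. -/
theorem ramify_coeff (d : ℕ+) (a : LaurentSeries ℂ) (k : ℤ) :
    (ramify d a).coeff (k * (d : ℚ)⁻¹) = a.coeff k := by
  exact HahnSeries.embDomain_coeff

/-- Refining the denominator: `ℂ((x^(1/d))) ⊆ ℂ((x^(1/(d e))))`. -/
theorem ramify_mem_of_mul (d e : ℕ+) (a : LaurentSeries ℂ) :
    ∃ b, ramify (d * e) b = ramify d a := by
  have hd : (d : ℚ) ≠ 0 := by simp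
  have he : (e : ℚ) ≠ 0 := by simp
  refine ⟨HahnSeries.embDomainRingHom (AddMonoidHom.mulRight (e : ℤ))
    (by intro m n h; simpa using h)
    (by
      intro m n
      have : (0 : ℤ) < (e : ℤ) := by exact_mod_cast e.pos
      simp) a, ?_⟩
  ext q
  by_cases hq : ∃ k : ℤ, q = k * (d : ℚ)⁻¹
  · obtain ⟨k, rfl⟩ := hq
    rw [ramify_coeff]
    have h1 : (k : ℚ) * (d : ℚ)⁻¹ = ((k * (e : ℤ) : ℤ) : ℚ) * ((d * e : ℕ+) : ℚ)⁻¹ := by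
      push_cast
      field_simp
    rw [h1, ramify_coeff]
    exact HahnSeries.embDomain_coeff
  · have h2 : (ramify d a).coeff q = 0 := by
      apply HahnSeries.embDomain_of_notMem_range
      rintro ⟨k, hk⟩
      exact hq ⟨k, hk.symm⟩
    rw [h2]
    by_cases hq' : ∃ k : ℤ, q = k * ((d * e : ℕ+) : ℚ)⁻¹
    · obtain ⟨k, rfl⟩ := hq'
      rw [ramify_coeff]
      apply HahnSeries.embDomain_of_notMem_range
      rintro ⟨m, hm⟩
      apply hq
      refine ⟨m, ?_⟩
      have : m * (e : ℤ) = k := hm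
      rw [← this]
      push_cast
      field_simp
    · apply HahnSeries.embDomain_of_notMem_range
      rintro ⟨k, hk⟩
      exact hq' ⟨k, hk.symm⟩

theorem exists_common_ramify {a b : HahnSeries ℚ ℂ} (ha : ∃ d : ℕ+, a ∈ (ramify d).range)
    (hb : ∃ d : ℕ+, b ∈ (ramify d).range) :
    ∃ d : ℕ+, a ∈ (ramify d).range ∧ b ∈ (ramify d).range := by
  obtain ⟨d, a, rfl⟩ := ha
  obtain ⟨e, b, rfl⟩ := hb
  refine ⟨d * e, ramify_mem_of_mul d e a, ?_⟩
  rw [mul_comm]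
  exact ramify_mem_of_mul e d b

/-- The field of Puiseux series `⋃_{d ≥ 1} ℂ[[x^(1/d)]][1/x]`, inside the Hahn series with rational
exponents. -/
noncomputable def Puiseux : Subfield (HahnSeries ℚ ℂ) where
  carrier := {a | ∃ d : ℕ+, a ∈ (ramify d).range}
  mul_mem' ha hb := by
    obtain ⟨d, ha, hb⟩ := exists_common_ramify ha hb
    exact ⟨d, mul_mem ha hb⟩
  one_mem' := ⟨1, one_mem _⟩
  add_mem' ha hb := by
    obtain ⟨d, ha, hb⟩ := exists_common_ramify ha hb
    exact ⟨d, add_mem ha hb⟩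
  zero_mem' := ⟨1, zero_mem _⟩
  neg_mem' := by
    rintro _ ⟨d, ha⟩
    exact ⟨d, neg_mem ha⟩
  inv_mem' := by
    rintro _ ⟨d, a, rfl⟩
    exact ⟨d, a⁻¹, map_inv₀ _ _⟩

/-- The inclusion `ℂ((x)) ⊆ ⋃_d ℂ((x^(1/d)))`. -/
noncomputable def toPuiseux : LaurentSeries ℂ →+* Puiseux :=
  (ramify 1).codRestrict Puiseux (fun a => ⟨1, a, rfl⟩)

/-- The `x`-adic valuation of a Puiseux series, with `ν 0 = ⊤`. -/
noncomputable def ν (a : Puiseux) : WithTop ℚ := (a : HahnSeries ℚ ℂ).orderTop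

/-- `f` viewed in `ℂ((x))[y]`. -/
noncomputable def overK (f : ℂ⟦X⟧[X]) : (LaurentSeries ℂ)[X] :=
  f.map (algebraMap ℂ⟦X⟧ (LaurentSeries ℂ))

/-- The partial derivative `∂f/∂x`: differentiate each coefficient with respect to `x`. (The
derivative `∂f/∂y` is `Polynomial.derivative f`.) -/
noncomputable def partialX (f : ℂ⟦X⟧[X]) : ℂ⟦X⟧[X] :=
  f.sum fun k a => Polynomial.monomial k (PowerSeries.derivative ℂ a)

theorem coeff_partialX (f : ℂ⟦X⟧[X]) (k : ℕ) :
    (partialX f).coeff k = PowerSeries.derivative ℂ (f.coeff k) := by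
  rw [partialX, Polynomial.sum_def, Polynomial.finsetSum_coeff]
  simp only [Polynomial.coeff_monomial]
  rw [Finset.sum_ite_eq']
  split_ifs with h
  · rfl
  · rw [Polynomial.notMem_support_iff.mp h, map_zero]

open Classical in
/-- The (finitely many, pairwise distinct) roots `a` of `f` in the field of Puiseux series. -/
noncomputable def branches (f : ℂ⟦X⟧[X]) : Finset Puiseux :=
  ((overK f).map toPuiseux).roots.toFinset

open Classical in
/-- `ε_a = ∏_{b ≠ a} (y - b)`, the product being over the distinct roots `b ≠ a` of `f`. -/
noncomputable def eps (f : ℂ⟦X⟧[X]) (a : Puiseux) : Puiseux[X] :=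
  ∏ b ∈ (branches f).erase a, (Polynomial.X - Polynomial.C b)

/-- `𝓔`: polynomials in `ℂ((x))[y]` of degree `< N`, with `N` the number of distinct roots. -/
noncomputable def spaceE (f : ℂ⟦X⟧[X]) : Submodule (LaurentSeries ℂ) (LaurentSeries ℂ)[X] :=
  Polynomial.degreeLT (LaurentSeries ℂ) (branches f).card

/-- `𝓕`: polynomials in `ℂ((x))[y]` of degree `< N - 1`. -/
noncomputable def spaceF (f : ℂ⟦X⟧[X]) : Submodule (LaurentSeries ℂ) (LaurentSeries ℂ)[X] :=
  Polynomial.degreeLT (LaurentSeries ℂ) ((branches f).card - 1)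

/-- `𝓔_r = 𝓔 ∩ ⨁_a {c | ν c ≥ r} ε_a`. -/
def filE (f : ℂ⟦X⟧[X]) (r : ℚ) : Set (LaurentSeries ℂ)[X] :=
  {w | w ∈ spaceE f ∧ ∃ c : Puiseux → Puiseux, (∀ a ∈ branches f, (r : WithTop ℚ) ≤ ν (c a)) ∧
    w.map toPuiseux = ∑ a ∈ branches f, Polynomial.C (c a) * eps f a}

/-- `𝓔_{>r} = 𝓔 ∩ ⨁_a {c | ν c > r} ε_a`. -/
def filEgt (f : ℂ⟦X⟧[X]) (r : ℚ) : Set (LaurentSeries ℂ)[X] :=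
  {w | w ∈ spaceE f ∧ ∃ c : Puiseux → Puiseux, (∀ a ∈ branches f, (r : WithTop ℚ) < ν (c a)) ∧
    w.map toPuiseux = ∑ a ∈ branches f, Polynomial.C (c a) * eps f a}

/-- `𝓕_r = 𝓔_r ∩ 𝓕`. -/
def filF (f : ℂ⟦X⟧[X]) (r : ℚ) : Set (LaurentSeries ℂ)[X] :=
  {w | w ∈ filE f r ∧ w ∈ spaceF f}

/-- The least common multiple of the degrees in `y` of the irreducible factors of `f` in
`ℂ[[x]][y]`. -/
noncomputable def lcmDegrees (f : ℂ⟦X⟧[X]) : ℕ :=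
  ((UniqueFactorizationMonoid.factors f).map Polynomial.natDegree).lcm

end PlaneBranches

/-! Put `g = ∏ (y - a_i)` and `θ = x d/dx`. The logarithmic derivatives `f'_y / f = ∑ μ_i / (y -
a_i)` and `x f'_x / f = -∑ μ_i θ(a_i) / (y - a_i)` turn `w f = u f'_x + v f'_y` into the nodal
equation `x w g = -u ∑ μ_i θ(a_i) ε_i + x v ∑ μ_i ε_i`, with no multiplicities in `g`.

In the basis `ε_i`, evaluation at `a_i` gives `x v_i = θ(a_i) u_i`, and partial fractions give `x
w_i = ∑_j (u_i μ_j - u_j μ_i) θ(a_i - a_j) / (a_i - a_j)` (`coefficients_of_nodal_equation`). Each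
quotient is integral with constant term `ν(a_i - a_j) > 0`. Hence, if some `u_i` had order below the
bound on the `x w_i`, the coefficients of least order would form a nonzero vector in the kernel of a
weighted Laplacian with positive weights. Its entries sum to zero because `deg u < N - 1`, and the
maximum principle excludes this (`le_orderTop_of_sum_mul_theta_div`). So `ν(u_i) ≥ r + 1`, and
`ν(a_i) > 0` then gives `ν(v_i) > r`.

Existence comes from the same estimate: for `w = 0` it gives injectivity of `(u, v) ↦ -u A + v B`,
where `A` and `B` are the two sums, and the dimensions `(N - 1) + N` agree. The system is solved
over Hahn series, brought down to `ℂ((x))` by a linear retraction, and the estimate is applied to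
the result. That `f` splits over the Puiseux series is the Newton–Puiseux theorem, proved by
Weierstrass preparation. -/

namespace PlaneBranches

/-! ### The Newton–Puiseux theorem. -/

/-- A monic polynomial over a complete local ring whose reduction vanishes at `0` without being
a power of the variable has a monic factor of intermediate degree. -/
theorem exists_monic_dvd_of_coeff_zero_mem {A : Type*} [CommRing A] [IsLocalRing A]
    [IsAdicComplete (IsLocalRing.maximalIdeal A) A] {G : A[X]}
    (h0 : G.coeff 0 ∈ IsLocalRing.maximalIdeal A) {i : ℕ} (hi : i < G.natDegree)
    (hGi : G.coeff i ∉ IsLocalRing.maximalIdeal A) :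
    ∃ P : A[X], P.Monic ∧ 0 < P.natDegree ∧ P.natDegree < G.natDegree ∧ P ∣ G := by
  have hne : (G : A⟦X⟧).map (IsLocalRing.residue A) ≠ 0 := by
    intro h
    have := congrArg (PowerSeries.coeff i) h
    rw [PowerSeries.coeff_map, Polynomial.coeff_coe, map_zero, IsLocalRing.residue_eq_zero_iff]
      at this
    exact hGi this
  -- Weierstrass preparation in `A⟦X⟧`: the degree of `P` is the order of the reduction of `G`,
  -- which is positive by `h0` and at most `i` by `hGi`.
  obtain ⟨P, h, H⟩ := (G : A⟦X⟧).exists_isWeierstrassFactorization hne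
  have hPm : P.Monic := H.isDistinguishedAt.monic
  have hdeg := H.natDegree_eq_toNat_order_map
  have hfin : (((G : A⟦X⟧).map (IsLocalRing.residue A)).order.toNat : ℕ∞) =
      ((G : A⟦X⟧).map (IsLocalRing.residue A)).order :=
    ENat.natCast_toNat (by simpa [PowerSeries.order_eq_top] using hne)
  refine ⟨P, hPm, ?_, ?_, ?_⟩
  · rw [hdeg, Nat.pos_iff_ne_zero]
    intro h00
    rw [h00] at hfin
    have := (PowerSeries.order_eq_nat.mp hfin.symm).1
    rw [PowerSeries.coeff_map, Polynomial.coeff_coe] at this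
    exact this ((IsLocalRing.residue_eq_zero_iff _).mpr h0)
  · rw [hdeg]
    have : ((G : A⟦X⟧).map (IsLocalRing.residue A)).order ≤ i := by
      apply PowerSeries.order_le
      rw [PowerSeries.coeff_map, Polynomial.coeff_coe]
      simpa [IsLocalRing.residue_eq_zero_iff] using hGi
    rw [← hfin] at this
    exact lt_of_le_of_lt (by exact_mod_cast this) hi
  -- `P` divides `G` as a power series. Uniqueness of Weierstrass division, compared with Euclidean
  -- division by `P`, makes the polynomial remainder vanish.
  · rw [← Polynomial.modByMonic_eq_zero_iff_dvd hPm]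
    have hdiv := H.isDistinguishedAt.isWeierstrassDivisorAt' (I := IsLocalRing.maximalIdeal A)
    have hPo : P.degree = (((P : A⟦X⟧).map (Ideal.Quotient.mk
        (IsLocalRing.maximalIdeal A))).order.toNat : ℕ) := by
      have := H.isDistinguishedAt.coe_natDegree_eq_order_map (P : A⟦X⟧) 1
        (by simp)
        (by simp)
      rw [← this, Polynomial.degree_eq_natDegree hPm.ne_zero]
      simp
    have hlt : (G %ₘ P).degree < (((P : A⟦X⟧).map (Ideal.Quotient.mk
        (IsLocalRing.maximalIdeal A))).order.toNat : ℕ) :=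
      hPo ▸ Polynomial.degree_modByMonic_lt _ hPm
    refine (hdiv.eq_of_mul_add_eq_mul_add (q := 0) (q' := h - (G /ₘ P : A[X])) (r := G %ₘ P)
      (r' := 0) hlt (by simp) ?_).2
    have h1 : (G : A⟦X⟧) = ((G %ₘ P + P * (G /ₘ P) : A[X]) : A⟦X⟧) := by
      rw [Polynomial.modByMonic_add_div]
    have h2 := H.eq_mul
    rw [mul_sub, ← h2]
    conv_rhs => rw [h1]
    simp

/-- Move a root `c` of the residue polynomial to `0`. The factorization fails only if the residue
polynomial is `(y - c) ^ n`; then the vanishing subleading coefficient forces `n c = 0`, so `c = 0`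
in characteristic zero, and `hGi` excludes `y ^ n`. -/
theorem exists_monic_dvd_powerSeries {k : Type*} [Field k] [IsAlgClosed k] [CharZero k]
    {G : k⟦X⟧[X]} (hG : G.Monic) (h1 : G.coeff (G.natDegree - 1) = 0) {i : ℕ}
    (hi : i < G.natDegree) (hGi : PowerSeries.constantCoeff (G.coeff i) ≠ 0) :
    ∃ P : k⟦X⟧[X], P.Monic ∧ 0 < P.natDegree ∧ P.natDegree < G.natDegree ∧ P ∣ G := by
  have : IsAdicComplete (IsLocalRing.maximalIdeal k⟦X⟧) k⟦X⟧ := by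
    rw [PowerSeries.maximalIdeal_eq_span_X]; infer_instance
  have hmem (a : k⟦X⟧) :
      a ∈ IsLocalRing.maximalIdeal k⟦X⟧ ↔ PowerSeries.constantCoeff a = 0 := by
    rw [PowerSeries.maximalIdeal_eq_span_X, Ideal.mem_span_singleton, PowerSeries.X_dvd_iff]
  set R := G.map (PowerSeries.constantCoeff (R := k)) with hR
  have hRm : R.Monic := hG.map _
  have hRd : R.natDegree = G.natDegree := hG.natDegree_map _
  obtain ⟨c, hc⟩ := IsAlgClosed.exists_root R (by
    rw [Polynomial.degree_eq_natDegree hRm.ne_zero, hRd]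
    exact_mod_cast (by omega : G.natDegree ≠ 0))
  have hmap : (Polynomial.taylor (PowerSeries.C c) G).map (PowerSeries.constantCoeff (R := k)) =
      Polynomial.taylor c R := by
    rw [Polynomial.map_taylor, PowerSeries.constantCoeff_C]
  have hcoeff (j : ℕ) : PowerSeries.constantCoeff
      ((Polynomial.taylor (PowerSeries.C c) G).coeff j) = (Polynomial.taylor c R).coeff j := by
    rw [← hmap, Polynomial.coeff_map]
  have hex : ∃ j < G.natDegree, (Polynomial.taylor c R).coeff j ≠ 0 := by
    by_contra! hall
    have hX : Polynomial.taylor c R = Polynomial.X ^ G.natDegree := by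
      ext j
      rw [Polynomial.coeff_X_pow]
      rcases lt_trichotomy j G.natDegree with h | h | h
      · rw [hall j h, if_neg h.ne]
      · rw [if_pos h, h, ← hRd, Polynomial.coeff_taylor_natDegree]; exact hRm
      · rw [if_neg h.ne', Polynomial.coeff_eq_zero_of_natDegree_lt]
        rwa [Polynomial.natDegree_taylor, hRd]
    have hR2 : R = (Polynomial.X + Polynomial.C (-c)) ^ G.natDegree := by
      have := congrArg (Polynomial.taylor (-c)) hX
      rw [Polynomial.taylor_taylor, neg_add_cancel, Polynomial.taylor_zero] at this
      rw [this, Polynomial.taylor_pow, Polynomial.taylor_X]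
    have hn1 : R.coeff (G.natDegree - 1) = 0 := by rw [hR, Polynomial.coeff_map, h1, map_zero]
    rw [hR2, Polynomial.coeff_X_add_C_pow, Nat.sub_sub_self (by omega), pow_one,
      Nat.choose_symm (by omega), Nat.choose_one_right] at hn1
    have hc0 : c = 0 := by
      rcases mul_eq_zero.mp hn1 with h | h
      · exact neg_eq_zero.mp h
      · exact absurd (Nat.cast_eq_zero.mp h) (by omega)
    apply hGi
    rw [← Polynomial.coeff_map, ← hR, hR2, hc0, neg_zero, Polynomial.C_0, add_zero,
      Polynomial.coeff_X_pow, if_neg hi.ne]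
  obtain ⟨j, hj, hjc⟩ := hex
  obtain ⟨P, hP, hP0, hPn, hPd⟩ := exists_monic_dvd_of_coeff_zero_mem
      (G := Polynomial.taylor (PowerSeries.C c) G)
    (by rw [hmem, hcoeff, Polynomial.taylor_coeff_zero]; exact hc) (i := j)
    (by rwa [Polynomial.natDegree_taylor]) (by rwa [hmem, hcoeff])
  rw [Polynomial.natDegree_taylor] at hPn
  refine ⟨Polynomial.taylor (-PowerSeries.C c) P, ?_, ?_, ?_, ?_⟩
  · rw [Polynomial.Monic, Polynomial.leadingCoeff_taylor]; exact hP
  · rwa [Polynomial.natDegree_taylor]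
  · rwa [Polynomial.natDegree_taylor]
  · obtain ⟨Q, hQ⟩ := hPd
    refine ⟨Polynomial.taylor (-PowerSeries.C c) Q, ?_⟩
    rw [← Polynomial.taylor_mul, ← hQ, Polynomial.taylor_taylor, neg_add_cancel,
      Polynomial.taylor_zero]

theorem coeff_taylor_natDegree_sub_one {k : Type*} [CommRing k] {F : k[X]} (hF : F.Monic)
    (hn : 0 < F.natDegree) (c : k) :
    (Polynomial.taylor c F).coeff (F.natDegree - 1) =
      F.coeff (F.natDegree - 1) + F.natDegree * c := by
  have hd : (Polynomial.hasseDeriv (F.natDegree - 1) F).natDegree < 2 :=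
    lt_of_le_of_lt (Polynomial.natDegree_hasseDeriv_le _ _) (by omega)
  rw [Polynomial.taylor_coeff, Polynomial.eval_eq_sum_range' hd]
  have h2 : 1 + (F.natDegree - 1) = F.natDegree := by omega
  rw [Finset.sum_range_succ, Finset.sum_range_one, Polynomial.hasseDeriv_coeff,
    Polynomial.hasseDeriv_coeff, h2, hF.coeff_natDegree,
    Nat.choose_symm (by omega), Nat.choose_one_right]
  simp

instance : CharZero (HahnSeries ℚ ℂ) :=
  charZero_of_injective_algebraMap (algebraMap ℂ (HahnSeries ℚ ℂ)).injective

instance : CharZero Puiseux :=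
  ⟨fun m n h => Nat.cast_injective (R := HahnSeries ℚ ℂ) (by
    have := congrArg Puiseux.subtype h
    simpa using this)⟩

/-- The Puiseux series `x ^ r`. -/
noncomputable def xpow (r : ℚ) : Puiseux :=
  ⟨HahnSeries.single r 1, ⟨r.den, r.den_pos⟩, HahnSeries.single r.num 1, by
    have : (((AddMonoidHom.mulRight (((⟨r.den, r.den_pos⟩ : ℕ+) : ℚ)⁻¹)).comp
        (Int.castAddHom ℚ)) r.num) = r := by
      simp [← div_eq_mul_inv, Rat.num_div_den]
    refine (HahnSeries.embDomain_single).trans ?_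
    exact congrArg (fun q => HahnSeries.single q (1 : ℂ)) this⟩

theorem xpow_ne_zero (r : ℚ) : xpow r ≠ 0 := by
  intro h
  have := congrArg Subtype.val h
  simp [xpow] at this

theorem coe_xpow (r : ℚ) : (xpow r : HahnSeries ℚ ℂ) = HahnSeries.single r 1 := rfl

theorem ν_mul (a b : Puiseux) : ν (a * b) = ν a + ν b := HahnSeries.orderTop_mul _ _

theorem ν_xpow_pow (r : ℚ) (n : ℕ) : ν (xpow r ^ n) = ((n * r : ℚ) : WithTop ℚ) := by
  rw [ν, SubmonoidClass.coe_pow, coe_xpow, HahnSeries.single_pow, one_pow,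
    HahnSeries.orderTop_single one_ne_zero, nsmul_eq_mul]

/-- The embedding `ℂ[[t]] → ⋃_d ℂ((x^(1/d)))`, `t ↦ x^(1/d)`. -/
noncomputable def powerSeriesRamify (d : ℕ+) : ℂ⟦X⟧ →+* Puiseux :=
  ((ramify d).codRestrict Puiseux
    (fun a => show ∃ e : ℕ+, ramify d a ∈ (ramify e).range from ⟨d, a, rfl⟩)).comp (HahnSeries.ofPowerSeries ℤ ℂ)

theorem powerSeriesRamify_injective (d : ℕ+) : Function.Injective (powerSeriesRamify d) := by
  intro a b h
  have h1 : ramify d (HahnSeries.ofPowerSeries ℤ ℂ a) =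
    ramify d (HahnSeries.ofPowerSeries ℤ ℂ b) := congrArg Subtype.val h
  exact HahnSeries.ofPowerSeries_injective ((ramify d).injective h1)

theorem coeff_zero_powerSeriesRamify (d : ℕ+) (a : ℂ⟦X⟧) :
    (powerSeriesRamify d a : HahnSeries ℚ ℂ).coeff 0 = PowerSeries.constantCoeff a := by
  have h := ramify_coeff d (HahnSeries.ofPowerSeries ℤ ℂ a) 0
  have h2 := LaurentSeries.coeff_coe_powerSeries a 0
  simp only [Int.cast_zero, zero_mul] at h
  rw [PowerSeries.coeff_zero_eq_constantCoeff_apply] at h2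
  exact h.trans h2

theorem mem_range_powerSeriesRamify {d : ℕ+} {a : Puiseux}
    (ha : (a : HahnSeries ℚ ℂ) ∈ (ramify d).range) (h0 : 0 ≤ ν a) :
    a ∈ Set.range (powerSeriesRamify d) := by
  obtain ⟨b, hb⟩ := ha
  refine ⟨PowerSeries.mk fun n => b.coeff n, Subtype.ext ?_⟩
  rw [← hb]
  change ramify d (HahnSeries.ofPowerSeries ℤ ℂ _) = _
  congr 1
  ext k
  rcases lt_or_ge k 0 with hk | hk
  · have h1 : b.coeff k = 0 := by
      rw [← ramify_coeff d, hb]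
      apply HahnSeries.coeff_eq_zero_of_lt_orderTop
      refine lt_of_lt_of_le ?_ h0
      have hd : (0 : ℚ) < (d : ℚ)⁻¹ := by simp
      have hk' : (k : ℚ) < 0 := by exact_mod_cast hk
      exact_mod_cast mul_neg_of_neg_of_pos hk' hd
    rw [h1]
    apply HahnSeries.embDomain_of_notMem_range
    rintro ⟨n, hn⟩
    have : (n : ℤ) = k := hn
    omega
  · lift k to ℕ using hk
    exact (LaurentSeries.coeff_coe_powerSeries _ k).trans (PowerSeries.coeff_mk _ _)

theorem exists_common_denominator (s : Finset Puiseux) :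
    ∃ d : ℕ+, ∀ a ∈ s, (a : HahnSeries ℚ ℂ) ∈ (ramify d).range := by
  classical
  induction s using Finset.induction_on with
  | empty => exact ⟨1, by simp⟩
  | insert a s _ ih =>
    obtain ⟨d, hd⟩ := ih
    obtain ⟨e, he⟩ := a.2
    refine ⟨d * e, fun b hb => ?_⟩
    rcases Finset.mem_insert.mp hb with rfl | hb
    · obtain ⟨c, hc⟩ := he
      rw [← hc, mul_comm]
      exact ramify_mem_of_mul e d c
    · obtain ⟨c, hc⟩ := hd b hb
      rw [← hc]
      exact ramify_mem_of_mul d e c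

/-- Finitely many coefficients have a common denominator, so an integral polynomial already lives
over a complete ring `ℂ[[x^(1/d)]]`, where Weierstrass preparation is available. -/
theorem exists_lift_powerSeries {G : Puiseux[X]} (hG : G.Monic) (h : ∀ i, 0 ≤ ν (G.coeff i)) :
    ∃ (d : ℕ+) (P : ℂ⟦X⟧[X]), P.map (powerSeriesRamify d) = G ∧
      P.natDegree = G.natDegree ∧ P.Monic := by
  classical
  obtain ⟨d, hd⟩ := exists_common_denominator ((Finset.range (G.natDegree + 1)).image G.coeff)
  refine ⟨d, Polynomial.lifts_and_natDegree_eq_and_monic ?_ hG⟩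
  rw [Polynomial.lifts_iff_coeff_lifts]
  intro n
  rcases lt_or_ge n (G.natDegree + 1) with hn | hn
  · exact mem_range_powerSeriesRamify
      (hd _ (Finset.mem_image_of_mem _ (Finset.mem_range.mpr hn))) (h n)
  · rw [Polynomial.coeff_eq_zero_of_natDegree_lt (by omega)]
    exact ⟨0, map_zero _⟩

/-- **Newton–Puiseux**: after a translation removing the subleading term, rescaling the variable
by a power of `x` produces an integral polynomial whose reduction has two distinct roots. -/
theorem exists_root_puiseux (n : ℕ) : ∀ F : Puiseux[X], F.Monic → F.natDegree = n → 0 < n →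
    ∃ z, F.eval z = 0 := by
  induction n using Nat.strong_induction_on with
  | _ n ih =>
  intro F₀ hF₀ hn₀ hn
  suffices H : ∀ F : Puiseux[X], F.Monic → F.natDegree = n → F.coeff (n - 1) = 0 →
      ∃ z, F.eval z = 0 by
    set c : Puiseux := -F₀.coeff (n - 1) / n
    obtain ⟨z, hz⟩ := H (Polynomial.taylor c F₀)
      (by rw [Polynomial.Monic, Polynomial.leadingCoeff_taylor]; exact hF₀)
      (by rw [Polynomial.natDegree_taylor, hn₀])
      (by
        have := coeff_taylor_natDegree_sub_one hF₀ (hn₀ ▸ hn) c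
        rw [hn₀] at this
        have hn' : (n : Puiseux) ≠ 0 := Nat.cast_ne_zero.mpr hn.ne'
        rw [this, mul_div_cancel₀ _ hn']
        ring)
    exact ⟨z + c, by rwa [Polynomial.taylor_eval] at hz⟩
  intro F hF hFn hF1
  by_cases hall : ∀ i < n, F.coeff i = 0
  · refine ⟨0, ?_⟩
    rw [← Polynomial.coeff_zero_eq_eval_zero]
    exact hall 0 hn
  classical
  push Not at hall
  obtain ⟨i₁, hi₁, hFi₁⟩ := hall
  set S := (Finset.range n).filter (fun i => F.coeff i ≠ 0)
  -- The minimum `r` is a slope of the Newton polygon: scaling the roots by `x ^ (-r)` makes every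
  -- coefficient integral and the coefficient of index `i₀` of valuation exactly zero.
  obtain ⟨i₀, hi₀, hmin⟩ := S.exists_min_image
    (fun i => (F.coeff i : HahnSeries ℚ ℂ).order / ((n : ℚ) - i))
    ⟨i₁, by simp [S, hi₁, hFi₁]⟩
  set r := (F.coeff i₀ : HahnSeries ℚ ℂ).order / ((n : ℚ) - i₀) with hr
  have hνc (i : ℕ) (hi : F.coeff i ≠ 0) :
      ν (F.coeff i) = ((F.coeff i : HahnSeries ℚ ℂ).order : ℚ) :=
    (HahnSeries.order_eq_orderTop_of_ne_zero (by simpa using hi)).symm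
  set G := F.scaleRoots (xpow (-r)) with hGdef
  have hGm : G.Monic := by
    rwa [hGdef, Polynomial.monic_scaleRoots_iff]
  have hGn : G.natDegree = n := by rw [hGdef, Polynomial.natDegree_scaleRoots, hFn]
  have hνG (i : ℕ) (hin : i < n) (hi : F.coeff i ≠ 0) : ν (G.coeff i) =
      (((F.coeff i : HahnSeries ℚ ℂ).order - r * ((n : ℚ) - i) : ℚ) : WithTop ℚ) := by
    rw [hGdef, Polynomial.coeff_scaleRoots, ν_mul, hνc i hi, ν_xpow_pow, hFn, ← WithTop.coe_add,
      Nat.cast_sub hin.le]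
    congr 1
    ring
  have hpos (i : ℕ) : 0 ≤ ν (G.coeff i) := by
    rcases lt_trichotomy i n with h | h | h
    · by_cases hi : F.coeff i = 0
      · rw [hGdef, Polynomial.coeff_scaleRoots, hi, zero_mul]
        simp [ν]
      · rw [hνG i h hi]
        have h1 := hmin i (by simp [S, h, hi])
        have h2 : (0 : ℚ) < (n : ℚ) - i := by
          have : (i : ℚ) < n := by exact_mod_cast h
          linarith
        rw [le_div_iff₀ h2] at h1
        exact_mod_cast sub_nonneg.mpr h1
    · rw [h, ← hGn, hGm.coeff_natDegree]
      simp [ν]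
    · rw [Polynomial.coeff_eq_zero_of_natDegree_lt (by omega)]
      simp [ν]
  obtain ⟨d, P, hPG, hPn, hPm⟩ := exists_lift_powerSeries hGm hpos
  have hi₀' : i₀ < n ∧ F.coeff i₀ ≠ 0 := by simpa [S] using hi₀
  obtain ⟨Q, hQm, hQ0, hQn, hQP⟩ := exists_monic_dvd_powerSeries hPm
    (by
      apply powerSeriesRamify_injective d
      rw [← Polynomial.coeff_map, hPG, hPn, hGn, hGdef, Polynomial.coeff_scaleRoots, hF1,
        zero_mul, map_zero])
    (i := i₀) (by rw [hPn, hGn]; exact hi₀'.1)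
    (by
      rw [← coeff_zero_powerSeriesRamify d, ← Polynomial.coeff_map, hPG]
      have h2 : (n : ℚ) - i₀ ≠ 0 := by
        have : (i₀ : ℚ) < n := by exact_mod_cast hi₀'.1
        linarith
      have h1 := hνG i₀ hi₀'.1 hi₀'.2
      rw [hr, div_mul_cancel₀ _ h2, sub_self] at h1
      exact HahnSeries.coeff_orderTop_ne h1)
  obtain ⟨z, hz⟩ := ih Q.natDegree (by omega) (Q.map (powerSeriesRamify d)) (hQm.map _)
    (hQm.natDegree_map _) hQ0
  have hGz : G.eval z = 0 := by
    rw [← hPG]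
    exact Polynomial.eval_eq_zero_of_dvd_of_eval_eq_zero
      (Polynomial.map_dvd (powerSeriesRamify d) hQP) hz
  refine ⟨(xpow (-r))⁻¹ * z, ?_⟩
  have := Polynomial.scaleRoots_eval₂_mul (p := F) (RingHom.id Puiseux) ((xpow (-r))⁻¹ * z)
    (xpow (-r))
  rw [RingHom.id_apply, mul_inv_cancel_left₀ (xpow_ne_zero _), ← Polynomial.eval,
    ← Polynomial.eval, ← hGdef, hGz] at this
  exact (mul_eq_zero.mp this.symm).resolve_left (pow_ne_zero _ (xpow_ne_zero _))

instance : IsAlgClosed Puiseux :=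
  IsAlgClosed.of_exists_root _ fun p hp hirr =>
    exists_root_puiseux _ p hp rfl hirr.natDegree_pos

/-! ### The basis `ε_i` and the nodal equation. -/

section Nodal

variable {F ι : Type*} [Field F] [DecidableEq ι] {s : Finset ι} {a : ι → F}

theorem eval_nodal_erase_self_ne_zero (ha : Set.InjOn a s) {k : ι} (hk : k ∈ s) :
    (Lagrange.nodal (s.erase k) a).eval (a k) ≠ 0 := by
  rw [Lagrange.eval_nodal, Finset.prod_ne_zero_iff]
  intro j hj
  rw [Finset.mem_erase] at hj
  exact sub_ne_zero.mpr fun h => hj.1 (ha hj.2 hk h.symm)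

theorem eval_sum_nodal_erase (c : ι → F) {k : ι} (hk : k ∈ s) :
    (∑ i ∈ s, Polynomial.C (c i) * Lagrange.nodal (s.erase i) a).eval (a k) =
      c k * (Lagrange.nodal (s.erase k) a).eval (a k) := by
  rw [Polynomial.eval_finsetSum, Finset.sum_eq_single_of_mem k hk, Polynomial.eval_C_mul]
  intro i _ hik
  rw [Polynomial.eval_C_mul,
    Lagrange.eval_nodal_at_node (Finset.mem_erase.mpr ⟨hik.symm, hk⟩), mul_zero]

theorem degree_sum_nodal_erase_lt (c : ι → F) :
    (∑ i ∈ s, Polynomial.C (c i) * Lagrange.nodal (s.erase i) a).degree < s.card := by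
  refine (Polynomial.degree_sum_le _ _).trans_lt ?_
  rw [Finset.sup_lt_iff (by simp)]
  intro i hi
  rw [← Polynomial.smul_eq_C_mul]
  refine (Polynomial.degree_smul_le _ _).trans_lt ?_
  rw [Lagrange.degree_nodal]
  exact_mod_cast Finset.card_erase_lt_of_mem hi

theorem eq_sum_nodal_erase (ha : Set.InjOn a s) {p : F[X]} (hp : p.degree < s.card) :
    p = ∑ i ∈ s, Polynomial.C (p.eval (a i) / (Lagrange.nodal (s.erase i) a).eval (a i)) *
      Lagrange.nodal (s.erase i) a := by
  refine Polynomial.eq_of_degrees_lt_of_eval_index_eq _ ha hp (degree_sum_nodal_erase_lt _) ?_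
  intro k hk
  rw [eval_sum_nodal_erase (fun i => p.eval (a i) / (Lagrange.nodal (s.erase i) a).eval (a i)) hk,
    div_mul_cancel₀ _ (eval_nodal_erase_self_ne_zero ha hk)]

/-- Each `ε_i` is monic of degree `N - 1`. Membership in `𝓕` is thus the condition that the
coordinates sum to zero. -/
theorem coeff_sum_nodal_erase (c : ι → F) :
    (∑ i ∈ s, Polynomial.C (c i) * Lagrange.nodal (s.erase i) a).coeff (s.card - 1) =
      ∑ i ∈ s, c i := by
  rw [Polynomial.finsetSum_coeff]
  refine Finset.sum_congr rfl fun i hi => ?_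
  have h := (Lagrange.nodal_monic (s := s.erase i) (v := a)).coeff_natDegree
  rw [Lagrange.natDegree_nodal, Finset.card_erase_of_mem hi] at h
  rw [Polynomial.coeff_C_mul, h, mul_one]

/-- Partial fractions for `1 / ((y - a_i) (y - a_j))`, with denominators cleared. -/
theorem nodal_erase_mul_nodal_erase {i j : ι} (hi : i ∈ s) (hj : j ∈ s) :
    Polynomial.C (a i - a j) * (Lagrange.nodal (s.erase i) a * Lagrange.nodal (s.erase j) a) =
      Lagrange.nodal s a * (Lagrange.nodal (s.erase i) a - Lagrange.nodal (s.erase j) a) := by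
  have h1 := Lagrange.nodal_eq_mul_nodal_erase (v := a) hi
  have h2 := Lagrange.nodal_eq_mul_nodal_erase (v := a) hj
  rw [Polynomial.C_sub]
  linear_combination Lagrange.nodal (s.erase j) a * h1 - Lagrange.nodal (s.erase i) a * h2

/-- Coefficients, in the basis `ε_i = ∏_{j ≠ i} (y - a_j)`, of a solution of
`w g = - u ∑ μ_j b_j ε_j + v ∑ μ_j ε_j`. -/
theorem coefficients_of_nodal_equation (ha : Set.InjOn a s) {m b u v w : ι → F}
    (hm : ∀ i ∈ s, m i ≠ 0)
    (h : (∑ i ∈ s, Polynomial.C (w i) * Lagrange.nodal (s.erase i) a) * Lagrange.nodal s a =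
      -((∑ i ∈ s, Polynomial.C (u i) * Lagrange.nodal (s.erase i) a) *
        ∑ i ∈ s, Polynomial.C (m i * b i) * Lagrange.nodal (s.erase i) a) +
      (∑ i ∈ s, Polynomial.C (v i) * Lagrange.nodal (s.erase i) a) *
        ∑ i ∈ s, Polynomial.C (m i) * Lagrange.nodal (s.erase i) a) :
    (∀ i ∈ s, v i = b i * u i) ∧
    ∀ i ∈ s, w i = ∑ j ∈ s, (u i * m j - u j * m i) * ((b i - b j) / (a i - a j)) := by
  -- At `a_k` the nodal polynomial and every `ε_i` with `i ≠ k` vanish.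
  have hv : ∀ i ∈ s, v i = b i * u i := by
    intro k hk
    have h1 := congrArg (Polynomial.eval (a k)) h
    rw [Polynomial.eval_mul, Lagrange.eval_nodal_at_node hk, mul_zero, Polynomial.eval_add,
      Polynomial.eval_neg, Polynomial.eval_mul, Polynomial.eval_mul, eval_sum_nodal_erase u hk,
      eval_sum_nodal_erase (fun i => m i * b i) hk, eval_sum_nodal_erase v hk,
      eval_sum_nodal_erase m hk] at h1
    have h2 := eval_nodal_erase_self_ne_zero ha hk
    have h3 := hm k hk
    have h4 : (m k * (Lagrange.nodal (s.erase k) a).eval (a k) ^ 2) * (v k - b k * u k) = 0 := by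
      linear_combination -h1
    exact sub_eq_zero.mp ((mul_eq_zero.mp h4).resolve_left (mul_ne_zero h3 (pow_ne_zero _ h2)))
  refine ⟨hv, ?_⟩
  set E : ι → F[X] := fun i => Lagrange.nodal (s.erase i) a with hE
  set c : ι → ι → F := fun i j => (b i - b j) / (a i - a j) with hc
  have hc' (i j : ι) : c j i = c i j := by
    simp only [hc]
    rw [← neg_sub (b i), ← neg_sub (a i), neg_div_neg_eq]
  have hprod : ∀ i ∈ s, ∀ j ∈ s, Polynomial.C (b i - b j) * (E i * E j) =
      Lagrange.nodal s a * (Polynomial.C (c i j) * (E i - E j)) := by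
    intro i hi j hj
    by_cases hij : i = j
    · simp [hij]
    have hne : a i - a j ≠ 0 := sub_ne_zero.mpr fun h => hij (ha hi hj h)
    rw [mul_left_comm (Lagrange.nodal s a), ← nodal_erase_mul_nodal_erase hi hj,
      ← mul_assoc (Polynomial.C (c i j)),
      ← Polynomial.C_mul, div_mul_cancel₀ _ hne]
  have hsum : (∑ i ∈ s, Polynomial.C (w i) * E i) = ∑ i ∈ s,
      Polynomial.C (∑ j ∈ s, (u i * m j - u j * m i) * c i j) * E i := by
    apply mul_right_cancel₀ (Lagrange.nodal_ne_zero (s := s) (v := a))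
    have hve : ∑ i ∈ s, Polynomial.C (v i) * E i = ∑ i ∈ s, Polynomial.C (b i * u i) * E i :=
      Finset.sum_congr rfl fun i hi => by rw [hv i hi]
    calc _ = -((∑ i ∈ s, Polynomial.C (u i) * E i) * ∑ j ∈ s, Polynomial.C (m j * b j) * E j) +
          (∑ i ∈ s, Polynomial.C (b i * u i) * E i) * ∑ j ∈ s, Polynomial.C (m j) * E j := by
            rw [h, hve]
      _ = ∑ i ∈ s, ∑ j ∈ s, Polynomial.C (u i * m j) * (Polynomial.C (b i - b j) * (E i * E j)) := by
            rw [Finset.sum_mul_sum, Finset.sum_mul_sum, ← Finset.sum_neg_distrib,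
              ← Finset.sum_add_distrib]
            refine Finset.sum_congr rfl fun i _ => ?_
            rw [← Finset.sum_neg_distrib, ← Finset.sum_add_distrib]
            refine Finset.sum_congr rfl fun j _ => ?_
            simp only [Polynomial.C_mul, Polynomial.C_sub]
            ring
      _ = ∑ i ∈ s, ∑ j ∈ s, (Polynomial.C (u i * m j * c i j) * E i * Lagrange.nodal s a -
            Polynomial.C (u i * m j * c i j) * E j * Lagrange.nodal s a) := by
            refine Finset.sum_congr rfl fun i hi => Finset.sum_congr rfl fun j hj => ?_
            rw [hprod i hi j hj]
            simp only [Polynomial.C_mul]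
            ring
      _ = _ := by
            -- Exchanging `i` and `j` in the second double sum and using the symmetry of `c`
            -- collects the coefficient of each `E i`.
            simp only [Finset.sum_sub_distrib]
            rw [Finset.sum_comm (f := fun i j => Polynomial.C (u i * m j * c i j) * E j *
              Lagrange.nodal s a), ← Finset.sum_sub_distrib, Finset.sum_mul]
            refine Finset.sum_congr rfl fun i _ => ?_
            rw [← Finset.sum_sub_distrib, map_sum, Finset.sum_mul, Finset.sum_mul]
            refine Finset.sum_congr rfl fun j _ => ?_
            rw [hc' i j, sub_mul (u i * m j)]
            simp only [Polynomial.C_mul, Polynomial.C_sub]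
            ring
  intro k hk
  have h1 := congrArg (Polynomial.eval (a k)) hsum
  rw [eval_sum_nodal_erase _ hk,
    eval_sum_nodal_erase (fun i => ∑ j ∈ s, (u i * m j - u j * m i) * c i j) hk] at h1
  exact mul_right_cancel₀ (eval_nodal_erase_self_ne_zero ha hk) h1

end Nodal

/-! ### Leibniz rules and the derivation `x d/dx` on Hahn series. -/

/-- The logarithmic derivative of `∏ p_i ^ m_i`, with denominators cleared. -/
theorem prod_mul_leibniz_prod_pow {A ι : Type*} [CommRing A] [DecidableEq ι]
    (D : A →+ A) (hD : ∀ p q, D (p * q) = p * D q + D p * q) (s : Finset ι) (p : ι → A) (m : ι → ℕ) :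
    (∏ i ∈ s, p i) * D (∏ i ∈ s, p i ^ m i) =
      (∏ i ∈ s, p i ^ m i) * ∑ i ∈ s, m i * D (p i) * ∏ j ∈ s.erase i, p j := by
  have h1 : D 1 = 0 := by simpa using hD 1 1
  have hpow (q : A) (n : ℕ) : q * D (q ^ n) = q ^ n * (n * D q) := by
    induction n with
    | zero => simp [h1]
    | succ n ih =>
      rw [pow_succ, hD]
      push_cast
      linear_combination q * ih
  induction s using Finset.induction_on with
  | empty => simp [h1]
  | insert k s hk ih =>
    rw [Finset.prod_insert hk, Finset.prod_insert hk, Finset.sum_insert hk,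
      Finset.erase_insert hk, hD]
    have hs : ∑ i ∈ s, (m i : A) * D (p i) * ∏ j ∈ (insert k s).erase i, p j =
        p k * ∑ i ∈ s, (m i : A) * D (p i) * ∏ j ∈ s.erase i, p j := by
      rw [Finset.mul_sum]
      refine Finset.sum_congr rfl fun i hi => ?_
      have hik : k ≠ i := fun h => hk (h ▸ hi)
      rw [Finset.erase_insert_of_ne hik, Finset.prod_insert (by simp [hk])]
      ring
    rw [hs]
    linear_combination (∏ i ∈ s, p i ^ m i) * (∏ i ∈ s, p i) * hpow (p k) (m k) + p k ^ m k * p k * ih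

/-- The derivation `x d/dx` on Hahn series, as an additive map. -/
noncomputable def theta : HahnSeries ℚ ℂ →+ HahnSeries ℚ ℂ where
  toFun a :=
    { coeff := fun q => q * a.coeff q
      isPWO_support' := a.isPWO_support.mono fun q hq => right_ne_zero_of_mul hq }
  map_zero' := by ext q; simp
  map_add' a b := by ext q; simp [mul_add]

@[simp]
theorem coeff_theta (a : HahnSeries ℚ ℂ) (q : ℚ) : (theta a).coeff q = q * a.coeff q := rfl

theorem support_theta_subset (a : HahnSeries ℚ ℂ) : (theta a).support ⊆ a.support :=
  fun _ hq => right_ne_zero_of_mul hq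

theorem theta_mul (a b : HahnSeries ℚ ℂ) : theta (a * b) = a * theta b + theta a * b := by
  ext q
  rw [coeff_theta, HahnSeries.coeff_add,
    HahnSeries.coeff_mul_left' a.isPWO_support (support_theta_subset a),
    HahnSeries.coeff_mul_right' b.isPWO_support (support_theta_subset b), HahnSeries.coeff_mul,
    Finset.mul_sum, ← Finset.sum_add_distrib]
  refine Finset.sum_congr rfl fun ij hij => ?_
  rw [← (Finset.mem_antidiagonal.mp hij).2.2, coeff_theta, coeff_theta]
  push_cast
  ring

theorem orderTop_le_orderTop_theta (a : HahnSeries ℚ ℂ) : a.orderTop ≤ (theta a).orderTop := by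
  rw [HahnSeries.le_orderTop_iff_forall]
  intro q hq
  rw [coeff_theta, HahnSeries.coeff_eq_zero_of_lt_orderTop hq, mul_zero]

/-- The exponents are only lower bounds for the orders: in the application the coefficient at `p`
may cancel in some of the combinations `u_i μ_j - u_j μ_i`. -/
theorem coeff_mul_of_le_orderTop {a b : HahnSeries ℚ ℂ} {p q : ℚ} (ha : p ≤ a.orderTop)
    (hb : q ≤ b.orderTop) : (a * b).coeff (p + q) = a.coeff p * b.coeff q := by
  by_cases hap : a.coeff p = 0
  · rw [hap, zero_mul]
    apply HahnSeries.coeff_eq_zero_of_lt_orderTop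
    rw [HahnSeries.orderTop_mul, WithTop.coe_add]
    exact WithTop.add_lt_add_of_lt_of_le WithTop.coe_ne_top
      (lt_of_le_of_ne ha (HahnSeries.orderTop_ne_of_coeff_eq_zero hap).symm) hb
  by_cases hbq : b.coeff q = 0
  · rw [hbq, mul_zero]
    apply HahnSeries.coeff_eq_zero_of_lt_orderTop
    rw [HahnSeries.orderTop_mul, WithTop.coe_add]
    exact WithTop.add_lt_add_of_le_of_lt WithTop.coe_ne_top ha
      (lt_of_le_of_ne hb (HahnSeries.orderTop_ne_of_coeff_eq_zero hbq).symm)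
  have hp : a.order = p := by
    have h0 : a ≠ 0 := HahnSeries.ne_zero_of_coeff_ne_zero hap
    have := HahnSeries.order_eq_orderTop_of_ne_zero h0
    exact WithTop.coe_injective
      (this.trans (le_antisymm (HahnSeries.orderTop_le_of_coeff_ne_zero hap) ha))
  have hq : b.order = q := by
    have h0 : b ≠ 0 := HahnSeries.ne_zero_of_coeff_ne_zero hbq
    have := HahnSeries.order_eq_orderTop_of_ne_zero h0
    exact WithTop.coe_injective
      (this.trans (le_antisymm (HahnSeries.orderTop_le_of_coeff_ne_zero hbq) hb))
  have := HahnSeries.coeff_mul_order_add_order a b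
  rwa [HahnSeries.leadingCoeff_eq, HahnSeries.leadingCoeff_eq, hp, hq] at this

/-- The logarithmic derivative of `a` is integral, with constant term the order of `a`. -/
theorem theta_div_self {a : HahnSeries ℚ ℂ} (ha : a ≠ 0) :
    0 ≤ (theta a / a).orderTop ∧ (theta a / a).coeff 0 = (a.order : ℂ) := by
  have hmul : theta a / a * a = theta a := div_mul_cancel₀ _ ha
  have ho := HahnSeries.order_eq_orderTop_of_ne_zero ha
  have h0 : 0 ≤ (theta a / a).orderTop := by
    have h := orderTop_le_orderTop_theta a
    rw [← hmul, HahnSeries.orderTop_mul, ← ho] at h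
    by_contra! hlt
    have := WithTop.add_lt_add_of_lt_of_le (WithTop.coe_ne_top (a := a.order)) hlt le_rfl
    rw [zero_add] at this
    exact absurd h this.not_ge
  refine ⟨h0, ?_⟩
  have h := coeff_mul_of_le_orderTop (p := 0) (q := a.order) h0 ho.le
  rw [hmul, zero_add, coeff_theta] at h
  have hc : a.coeff a.order ≠ 0 := HahnSeries.coeff_orderTop_ne ho.symm
  exact (mul_right_cancel₀ hc h).symm

/-! ### The Laplacian and the order estimate. -/

/-- The weighted Laplacian of a complete graph with positive weights is injective on vectors of
sum zero. -/
theorem eq_zero_of_laplacian_eq_zero_real {ι : Type*} {s : Finset ι} {m t : ι → ℝ}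
    {κ : ι → ι → ℝ} (hm : ∀ i ∈ s, 0 < m i) (hκ : ∀ i ∈ s, ∀ j ∈ s, i ≠ j → 0 < κ i j)
    (h : ∀ i ∈ s, ∑ j ∈ s, (t i * m j - t j * m i) * κ i j = 0) (ht : ∑ i ∈ s, t i = 0) :
    ∀ i ∈ s, t i = 0 := by
  rcases s.eq_empty_or_nonempty with rfl | hs
  · simp
  -- Maximum principle: where `t / m` is largest, the terms of the equation are nonnegative with sum
  -- zero, so `t` is proportional to `m`; its zero sum then forces `t = 0`.
  obtain ⟨i, hi, hmax⟩ := s.exists_max_image (fun i => t i / m i) hs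
  have hle : ∀ j ∈ s, 0 ≤ t i * m j - t j * m i := by
    intro j hj
    have := hmax j hj
    rw [div_le_div_iff₀ (hm j hj) (hm i hi)] at this
    linarith
  have heq : ∀ j ∈ s, t i * m j - t j * m i = 0 := by
    intro j hj
    by_cases hij : i = j
    · rw [hij, sub_self]
    have hnn : ∀ k ∈ s, 0 ≤ (t i * m k - t k * m i) * κ i k := by
      intro k hk
      by_cases hik : i = k
      · rw [hik, sub_self, zero_mul]
      · exact mul_nonneg (hle k hk) (hκ i hi k hk hik).le
    have := (Finset.sum_eq_zero_iff_of_nonneg hnn).mp (h i hi) j hj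
    exact (mul_eq_zero.mp this).resolve_right (hκ i hi j hj hij).ne'
  have hti : t i = 0 := by
    have h1 : ∑ j ∈ s, (t i * m j - t j * m i) = 0 := Finset.sum_eq_zero heq
    rw [Finset.sum_sub_distrib, ← Finset.mul_sum, ← Finset.sum_mul, ht, zero_mul, sub_zero] at h1
    exact (mul_eq_zero.mp h1).resolve_right (Finset.sum_pos hm hs).ne'
  intro j hj
  have := heq j hj
  rw [hti, zero_mul, zero_sub, neg_eq_zero] at this
  exact (mul_eq_zero.mp this).resolve_right (hm i hi).ne'

theorem eq_zero_of_laplacian_eq_zero {ι : Type*} {s : Finset ι} {m : ι → ℝ} {t : ι → ℂ}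
    {κ : ι → ι → ℝ} (hm : ∀ i ∈ s, 0 < m i) (hκ : ∀ i ∈ s, ∀ j ∈ s, i ≠ j → 0 < κ i j)
    (h : ∀ i ∈ s, ∑ j ∈ s, (t i * m j - t j * m i) * κ i j = 0) (ht : ∑ i ∈ s, t i = 0) :
    ∀ i ∈ s, t i = 0 := by
  intro i hi
  apply Complex.ext
  · refine eq_zero_of_laplacian_eq_zero_real (t := fun i => (t i).re) hm hκ (fun i hi => ?_) ?_ i hi
    · simpa [Complex.re_sum] using congrArg Complex.re (h i hi)
    · simpa [Complex.re_sum] using congrArg Complex.re ht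
  · refine eq_zero_of_laplacian_eq_zero_real (t := fun i => (t i).im) hm hκ (fun i hi => ?_) ?_ i hi
    · simpa [Complex.im_sum] using congrArg Complex.im (h i hi)
    · simpa [Complex.im_sum] using congrArg Complex.im ht

/-- If the least order `p` of the `u i` were below `r`, the coefficients at `p` of the equations
would be a homogeneous Laplacian system for the coefficients of the `u i`. -/
theorem le_orderTop_of_sum_mul_theta_div {ι : Type*} {s : Finset ι} {m : ι → ℕ}
    {a u w : ι → HahnSeries ℚ ℂ} (hm : ∀ i ∈ s, m i ≠ 0) (ha : Set.InjOn a s)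
    (ha0 : ∀ i ∈ s, 0 < (a i).orderTop) (hu : ∑ i ∈ s, u i = 0)
    (hw : ∀ i ∈ s, w i = ∑ j ∈ s, (u i * m j - u j * m i) *
      ((theta (a i) - theta (a j)) / (a i - a j)))
    {r : ℚ} (hr : ∀ i ∈ s, r ≤ (w i).orderTop) : ∀ i ∈ s, r ≤ (u i).orderTop := by
  by_contra! hlt
  obtain ⟨i₁, hi₁, hlt₁⟩ := hlt
  obtain ⟨i₀, hi₀, hmin⟩ := s.exists_min_image (fun i => (u i).orderTop) ⟨i₁, hi₁⟩
  have hlt₀ : (u i₀).orderTop < r := (hmin i₁ hi₁).trans_lt hlt₁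
  obtain ⟨p, hp⟩ := WithTop.ne_top_iff_exists.mp (hlt₀.trans (WithTop.coe_lt_top r)).ne
  have hpr : (p : WithTop ℚ) < r := hp ▸ hlt₀
  refine HahnSeries.coeff_orderTop_ne hp.symm ?_
  have hnat (v : HahnSeries ℚ ℂ) (n : ℕ) : (v * n).coeff p = v.coeff p * n := by
    rw [← nsmul_eq_mul', HahnSeries.coeff_nsmul, Pi.smul_apply, nsmul_eq_mul']
  have hple (v : HahnSeries ℚ ℂ) (n : ℕ) (hv : p ≤ v.orderTop) : p ≤ (v * n).orderTop := by
    rw [HahnSeries.le_orderTop_iff_forall] at hv ⊢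
    intro q hq
    rw [← nsmul_eq_mul', HahnSeries.coeff_nsmul, Pi.smul_apply, hv q hq, smul_zero]
  -- The weights are the constant terms of `θ(a_i - a_j) / (a_i - a_j)`, that is, the orders of `a_i
  -- - a_j`; they are positive since all the `a_i` have positive order.
  refine eq_zero_of_laplacian_eq_zero (s := s) (m := fun i => m i)
    (t := fun i => (u i).coeff p) (κ := fun i j => ((a i - a j).order : ℝ)) ?_ ?_ ?_ ?_ i₀ hi₀
  · intro i hi
    exact_mod_cast Nat.pos_of_ne_zero (hm i hi)
  · intro i hi j hj hij
    have hne : a i - a j ≠ 0 := sub_ne_zero.mpr fun h => hij (ha hi hj h)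
    have h1 := (lt_min (ha0 i hi) (ha0 j hj)).trans_le HahnSeries.min_orderTop_le_orderTop_sub
    rw [HahnSeries.zero_lt_orderTop_iff hne] at h1
    exact_mod_cast h1
  · intro i hi
    have hz : (w i).coeff p = 0 :=
      HahnSeries.coeff_eq_zero_of_lt_orderTop (hpr.trans_le (hr i hi))
    rw [hw i hi, HahnSeries.coeff_sum] at hz
    rw [← hz]
    refine Finset.sum_congr rfl fun j hj => ?_
    by_cases hij : i = j
    · simp [hij]
    have hne : a i - a j ≠ 0 := sub_ne_zero.mpr fun h => hij (ha hi hj h)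
    obtain ⟨h0, h1⟩ := theta_div_self hne
    rw [map_sub] at h0 h1
    have h2 : (p : WithTop ℚ) ≤ (u i * m j - u j * m i).orderTop :=
      (le_min (hple _ _ (hp.le.trans (hmin i hi))) (hple _ _ (hp.le.trans (hmin j hj)))).trans
        HahnSeries.min_orderTop_le_orderTop_sub
    have h3 := coeff_mul_of_le_orderTop (q := 0) h2 h0
    rw [add_zero] at h3
    rw [h3, h1, HahnSeries.coeff_sub, hnat, hnat]
    push_cast
    ring
  · rw [← HahnSeries.coeff_sum, hu, HahnSeries.coeff_zero]

/-! ### Coefficientwise maps and logarithmic derivatives of polynomials. -/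

theorem coeff_sum_monomial_map {A B : Type*} [Semiring A] [Semiring B] (φ : A →+ B) (p : A[X])
    (n : ℕ) : (∑ i ∈ p.support, Polynomial.monomial i (φ (p.coeff i))).coeff n =
      φ (p.coeff n) := by
  simp only [Polynomial.finsetSum_coeff, Polynomial.coeff_monomial]
  rw [Finset.sum_ite_eq']
  split_ifs with hn
  · rfl
  · rw [Polynomial.notMem_support_iff.mp hn, map_zero]

/-- Apply an additive map to the coefficients of a polynomial. -/
noncomputable def mapCoeff {A B : Type*} [Semiring A] [Semiring B] (φ : A →+ B) : A[X] →+ B[X] where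
  toFun p := ∑ i ∈ p.support, Polynomial.monomial i (φ (p.coeff i))
  map_zero' := by simp
  map_add' p q := by
    ext n
    rw [Polynomial.coeff_add, coeff_sum_monomial_map, coeff_sum_monomial_map,
      coeff_sum_monomial_map, Polynomial.coeff_add, map_add]

@[simp]
theorem coeff_mapCoeff {A B : Type*} [Semiring A] [Semiring B] (φ : A →+ B) (p : A[X]) (n : ℕ) :
    (mapCoeff φ p).coeff n = φ (p.coeff n) :=
  coeff_sum_monomial_map φ p n

theorem degree_mapCoeff_lt {A B : Type*} [Semiring A] [Semiring B] (φ : A →+ B) {p : A[X]} {n : ℕ}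
    (hp : p.degree < n) : (mapCoeff φ p).degree < n := by
  rw [Polynomial.degree_lt_iff_coeff_zero] at hp ⊢
  intro k hk
  rw [coeff_mapCoeff, hp k hk, map_zero]

theorem mapCoeff_mul_of_leibniz {A : Type*} [CommRing A] (D : A →+ A)
    (hD : ∀ a b, D (a * b) = a * D b + D a * b) (p q : A[X]) :
    mapCoeff D (p * q) = p * mapCoeff D q + mapCoeff D p * q := by
  ext n
  simp only [coeff_mapCoeff, Polynomial.coeff_add, Polynomial.coeff_mul, map_sum, hD,
    Finset.sum_add_distrib]

theorem mapCoeff_X_sub_C {A : Type*} [CommRing A] {D : A →+ A} (h1 : D 1 = 0) (a : A) :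
    mapCoeff D (Polynomial.X - Polynomial.C a) = -Polynomial.C (D a) := by
  ext n : 1
  rw [coeff_mapCoeff, Polynomial.coeff_sub, map_sub, Polynomial.coeff_neg, Polynomial.coeff_X,
    Polynomial.coeff_C, Polynomial.coeff_C]
  split_ifs with h h' <;> simp [h1]

section LogDerivative

variable {F ι : Type*} [Field F] [DecidableEq ι] (s : Finset ι) (a : ι → F) (m : ι → ℕ)

theorem nodal_mul_mapCoeff_prod (D : F →+ F) (hD : ∀ a b, D (a * b) = a * D b + D a * b) :
    Lagrange.nodal s a * mapCoeff D (∏ i ∈ s, (Polynomial.X - Polynomial.C (a i)) ^ m i) =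
      -((∏ i ∈ s, (Polynomial.X - Polynomial.C (a i)) ^ m i) *
        ∑ i ∈ s, Polynomial.C (m i * D (a i)) * Lagrange.nodal (s.erase i) a) := by
  rw [Lagrange.nodal, prod_mul_leibniz_prod_pow _ (mapCoeff_mul_of_leibniz D hD), ← mul_neg,
    ← Finset.sum_neg_distrib]
  congr 1
  refine Finset.sum_congr rfl fun i _ => ?_
  rw [mapCoeff_X_sub_C (by simpa using hD 1 1), Lagrange.nodal, Polynomial.C_mul,
    Polynomial.C_eq_natCast]
  ring

theorem nodal_mul_derivative_prod :
    Lagrange.nodal s a *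
      Polynomial.derivative (∏ i ∈ s, (Polynomial.X - Polynomial.C (a i)) ^ m i) =
      (∏ i ∈ s, (Polynomial.X - Polynomial.C (a i)) ^ m i) *
        ∑ i ∈ s, Polynomial.C (m i : F) * Lagrange.nodal (s.erase i) a := by
  have h := prod_mul_leibniz_prod_pow
    (Polynomial.derivative : F[X] →ₗ[F] F[X]).toAddMonoidHom
    (fun p q => (Polynomial.derivative_mul).trans (add_comm _ _)) s
    (fun i => Polynomial.X - Polynomial.C (a i)) m
  rw [LinearMap.toAddMonoidHom_coe] at h
  rw [Lagrange.nodal, h]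
  congr 1
  refine Finset.sum_congr rfl fun i _ => ?_
  rw [Polynomial.derivative_X_sub_C, mul_one, Lagrange.nodal, Polynomial.C_eq_natCast]

/-- Here `A / g` and `B / g` stand for `-x f'_x / f` and `f'_y / f`. -/
theorem equation_iff_of_logDerivative {R : Type*} [CommRing R] [IsDomain R]
    {f fx fy g A B x : R} (hf : f ≠ 0) (hg : g ≠ 0) (hx : x ≠ 0) (hX : g * (x * fx) = -(f * A))
    (hY : g * fy = f * B) (u v w : R) :
    (x * w) * g = -(u * A) + (x * v) * B ↔ w * f = u * fx + v * fy := by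
  constructor
  · intro h
    apply mul_left_cancel₀ (mul_ne_zero hg hx)
    linear_combination f * h - u * hX - x * v * hY
  · intro h
    apply mul_left_cancel₀ hf
    linear_combination g * x * h + u * hX + x * v * hY

end LogDerivative

/-! ### Solving the nodal equation over Hahn series by a dimension count. -/

theorem degree_mul_lt {F : Type*} [Field F] {p q : F[X]} {k l : ℕ} (hp : p.degree < k)
    (hq : q.degree < l) : (p * q).degree < (k + l - 1 : ℕ) := by
  by_cases hp0 : p = 0
  · rw [hp0, zero_mul, Polynomial.degree_zero]; exact WithBot.bot_lt_coe _
  by_cases hq0 : q = 0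
  · rw [hq0, mul_zero, Polynomial.degree_zero]; exact WithBot.bot_lt_coe _
  rw [← Polynomial.natDegree_lt_iff_degree_lt hp0] at hp
  rw [← Polynomial.natDegree_lt_iff_degree_lt hq0] at hq
  rw [← Polynomial.natDegree_lt_iff_degree_lt (mul_ne_zero hp0 hq0),
    Polynomial.natDegree_mul hp0 hq0]
  omega

theorem sum_eq_zero_of_degree_lt {F ι : Type*} [Field F] [DecidableEq ι] {s : Finset ι}
    {a c : ι → F} (h : (∑ i ∈ s, Polynomial.C (c i) * Lagrange.nodal (s.erase i) a).degree <
      (s.card - 1 : ℕ)) : ∑ i ∈ s, c i = 0 := by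
  rw [← coeff_sum_nodal_erase (a := a) c]
  exact Polynomial.coeff_eq_zero_of_degree_lt h

theorem finrank_degreeLT {F : Type*} [Field F] (n : ℕ) :
    Module.finrank F (Polynomial.degreeLT F n) = n := by
  rw [(Polynomial.degreeLTEquiv F n).finrank_eq, Module.finrank_fin_fun]

/-- A two-generator linear combination map between spaces of polynomials of bounded degree is
surjective as soon as it is injective. -/
theorem exists_combination_of_injective {F : Type*} [Field F] {N : ℕ} {A B : F[X]} (hN : 0 < N)
    (hA : A.degree < N) (hB : B.degree < N)
    (hinj : ∀ u v : F[X], u.degree < (N - 1 : ℕ) → v.degree < N → -(u * A) + v * B = 0 →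
      u = 0 ∧ v = 0) {p : F[X]} (hp : p.degree < (N - 1 + N : ℕ)) :
    ∃ u v : F[X], u.degree < (N - 1 : ℕ) ∧ v.degree < N ∧ p = -(u * A) + v * B := by
  have hfin (n : ℕ) : FiniteDimensional F (Polynomial.degreeLT F n) :=
    Module.Finite.equiv (Polynomial.degreeLTEquiv F n).symm
  let Φ : (Polynomial.degreeLT F (N - 1) × Polynomial.degreeLT F N) →ₗ[F]
      Polynomial.degreeLT F (N - 1 + N) :=
    { toFun := fun p => ⟨-((p.1 : F[X]) * A) + (p.2 : F[X]) * B, by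
        have h1 := degree_mul_lt (Polynomial.mem_degreeLT.mp p.1.2) hA
        have h2 := degree_mul_lt (Polynomial.mem_degreeLT.mp p.2.2) hB
        refine add_mem (neg_mem (Polynomial.mem_degreeLT.mpr (h1.trans_le ?_)))
          (Polynomial.mem_degreeLT.mpr (h2.trans_le ?_)) <;> norm_cast <;> omega⟩
      map_add' := fun p q => Subtype.ext (by
        simp only [Prod.fst_add, Prod.snd_add, Submodule.coe_add]
        ring)
      map_smul' := fun c p => Subtype.ext (by
        simp only [Prod.smul_fst, Prod.smul_snd, Submodule.coe_smul, Polynomial.smul_eq_C_mul,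
          RingHom.id_apply]
        ring) }
  have hΦ : Function.Injective Φ := by
    rw [injective_iff_map_eq_zero]
    rintro ⟨u, v⟩ huv
    obtain ⟨h1, h2⟩ := hinj u v (Polynomial.mem_degreeLT.mp u.2)
      (Polynomial.mem_degreeLT.mp v.2) (congrArg Subtype.val huv)
    exact Prod.ext (Subtype.ext h1) (Subtype.ext h2)
  obtain ⟨⟨u, v⟩, huv⟩ := (LinearMap.injective_iff_surjective_of_finrank_eq_finrank (by
    rw [Module.finrank_prod, finrank_degreeLT, finrank_degreeLT, finrank_degreeLT])).mp hΦ
      ⟨p, Polynomial.mem_degreeLT.mpr hp⟩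
  exact ⟨u, v, Polynomial.mem_degreeLT.mp u.2, Polynomial.mem_degreeLT.mp v.2,
    (congrArg Subtype.val huv).symm⟩

section Hahn

variable {ι : Type*} [DecidableEq ι] {s : Finset ι} {m : ι → ℕ} {a : ι → HahnSeries ℚ ℂ}

/-- With `w = 0` the order estimate holds for every `r`, so all coordinates of `u` have infinite
order; those of `v` are multiples of them. -/
theorem eq_zero_of_nodal_equation (hm : ∀ i ∈ s, m i ≠ 0) (ha : Set.InjOn a s)
    (ha0 : ∀ i ∈ s, 0 < (a i).orderTop) {u v : (HahnSeries ℚ ℂ)[X]}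
    (hu : u.degree < (s.card - 1 : ℕ)) (hv : v.degree < s.card)
    (h : -(u * ∑ i ∈ s, Polynomial.C (m i * theta (a i)) * Lagrange.nodal (s.erase i) a) +
      v * ∑ i ∈ s, Polynomial.C (m i : HahnSeries ℚ ℂ) * Lagrange.nodal (s.erase i) a = 0) :
    u = 0 ∧ v = 0 := by
  have hu' : u.degree < s.card := hu.trans_le (by exact_mod_cast Nat.sub_le _ _)
  have hue := eq_sum_nodal_erase ha hu'
  have hve := eq_sum_nodal_erase ha hv
  set uc := fun i => u.eval (a i) / (Lagrange.nodal (s.erase i) a).eval (a i)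
  set vc := fun i => v.eval (a i) / (Lagrange.nodal (s.erase i) a).eval (a i)
  have key := coefficients_of_nodal_equation (m := fun i => (m i : HahnSeries ℚ ℂ))
    (b := fun i => theta (a i)) (u := uc) (v := vc) (w := fun _ => 0) ha
    (fun i hi => Nat.cast_ne_zero.mpr (hm i hi))
    (by
      rw [← hue, ← hve]
      simpa using h.symm)
  rw [hue] at hu
  have huc : ∀ i ∈ s, uc i = 0 := by
    intro i hi
    rw [← HahnSeries.orderTop_eq_top, WithTop.eq_top_iff_forall_ge]
    intro r
    exact le_orderTop_of_sum_mul_theta_div hm ha ha0 (sum_eq_zero_of_degree_lt hu) key.2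
      (r := r) (by simp) i hi
  constructor
  · rw [hue]
    refine Finset.sum_eq_zero fun i hi => ?_
    change Polynomial.C (uc i) * _ = 0
    rw [huc i hi, Polynomial.C_0, zero_mul]
  · rw [hve]
    refine Finset.sum_eq_zero fun i hi => ?_
    change Polynomial.C (vc i) * _ = 0
    rw [key.1 i hi, huc i hi, mul_zero, Polynomial.C_0, zero_mul]

theorem exists_nodal_solution (hs : s.Nonempty) (hm : ∀ i ∈ s, m i ≠ 0) (ha : Set.InjOn a s)
    (ha0 : ∀ i ∈ s, 0 < (a i).orderTop) {w : (HahnSeries ℚ ℂ)[X]}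
    (hw : w.degree < (s.card - 1 : ℕ)) :
    ∃ u v : (HahnSeries ℚ ℂ)[X], u.degree < (s.card - 1 : ℕ) ∧ v.degree < s.card ∧
      w * Lagrange.nodal s a =
        -(u * ∑ i ∈ s, Polynomial.C (m i * theta (a i)) * Lagrange.nodal (s.erase i) a) +
        v * ∑ i ∈ s, Polynomial.C (m i : HahnSeries ℚ ℂ) * Lagrange.nodal (s.erase i) a := by
  refine exists_combination_of_injective hs.card_pos (degree_sum_nodal_erase_lt _)
    (degree_sum_nodal_erase_lt _) (fun u v => eq_zero_of_nodal_equation hm ha ha0) ?_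
  have h1 : (Lagrange.nodal s a).degree < (s.card + 1 : ℕ) := by
    rw [Lagrange.degree_nodal]; exact_mod_cast Nat.lt_succ_self _
  exact (degree_mul_lt hw h1).trans_le (by norm_cast)

end Hahn

/-! ### Retractions, and the passage from power series to Hahn series. -/

/-- A linear retraction of a field extension, as an additive map. -/
theorem exists_retraction {K L : Type*} [Field K] [Field L] (σ : K →+* L) :
    ∃ φ : L →+ K, ∀ a k, φ (a * σ k) = φ a * k ∧ φ (σ k) = k := by
  let _ := σ.toAlgebra
  obtain ⟨φ, hφ⟩ := LinearMap.exists_leftInverse_of_injective (Algebra.linearMap K L)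
    (LinearMap.ker_eq_bot.mpr (algebraMap K L).injective)
  refine ⟨φ.toAddMonoidHom, fun a k => ⟨?_, LinearMap.congr_fun hφ k⟩⟩
  have : a * σ k = k • a := by rw [Algebra.smul_def, mul_comm]; rfl
  rw [this]
  exact (φ.map_smul k a).trans (mul_comm _ _)

theorem mapCoeff_mul_map {K L : Type*} [Field K] [Field L] {σ : K →+* L} {φ : L →+ K}
    (hφ : ∀ a k, φ (a * σ k) = φ a * k) (p : L[X]) (q : K[X]) :
    mapCoeff φ (p * q.map σ) = mapCoeff φ p * q := by
  ext n
  simp only [coeff_mapCoeff, Polynomial.coeff_mul, map_sum, Polynomial.coeff_map, hφ]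

theorem coeff_powerSeriesRamify_of_neg (d : ℕ+) (a : ℂ⟦X⟧) {q : ℚ} (hq : q < 0) :
    (powerSeriesRamify d a : HahnSeries ℚ ℂ).coeff q = 0 := by
  change (ramify d (HahnSeries.ofPowerSeries ℤ ℂ a)).coeff q = 0
  by_cases h : ∃ k : ℤ, q = k * (d : ℚ)⁻¹
  · obtain ⟨k, rfl⟩ := h
    rw [ramify_coeff]
    apply HahnSeries.embDomain_of_notMem_range
    rintro ⟨n, hn⟩
    have hk : (n : ℤ) = k := hn
    rw [← hk] at hq
    have : (0 : ℚ) ≤ ((n : ℤ) : ℚ) * (d : ℚ)⁻¹ := by positivity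
    exact absurd hq this.not_gt
  · apply HahnSeries.embDomain_of_notMem_range
    rintro ⟨k, hk⟩
    exact h ⟨k, hk.symm⟩

theorem ν_powerSeriesRamify_pos (d : ℕ+) {a : ℂ⟦X⟧} (ha : PowerSeries.constantCoeff a = 0) :
    0 < ν (powerSeriesRamify d a) := by
  refine lt_of_le_of_ne ?_ (HahnSeries.orderTop_ne_of_coeff_eq_zero (i := (0 : ℚ)) ?_).symm
  · rw [ν, HahnSeries.le_orderTop_iff_forall]
    exact fun j hj => coeff_powerSeriesRamify_of_neg d a (by exact_mod_cast hj)
  · rw [coeff_zero_powerSeriesRamify, ha]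

theorem theta_powerSeriesRamify_one (a : ℂ⟦X⟧) :
    theta (powerSeriesRamify 1 a : HahnSeries ℚ ℂ) =
      HahnSeries.single 1 1 *
        (powerSeriesRamify 1 (PowerSeries.derivative ℂ a) : HahnSeries ℚ ℂ) := by
  have hnat (b : ℂ⟦X⟧) (n : ℕ) : (powerSeriesRamify 1 b : HahnSeries ℚ ℂ).coeff n =
      PowerSeries.coeff n b := by
    have := ramify_coeff 1 (HahnSeries.ofPowerSeries ℤ ℂ b) n
    simp only [PNat.one_coe, Nat.cast_one, inv_one, mul_one, Int.cast_natCast] at this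
    exact this.trans (LaurentSeries.coeff_coe_powerSeries b n)
  have hnot (b : ℂ⟦X⟧) (q : ℚ) (hq : ∀ n : ℕ, q ≠ n) :
      (powerSeriesRamify 1 b : HahnSeries ℚ ℂ).coeff q = 0 := by
    rcases lt_or_ge q 0 with h | h
    · exact coeff_powerSeriesRamify_of_neg 1 b h
    · apply HahnSeries.embDomain_of_notMem_range
      rintro ⟨k, hk⟩
      have hk' : (k : ℚ) * ((1 : ℕ+) : ℚ)⁻¹ = q := hk
      simp only [PNat.one_coe, Nat.cast_one, inv_one, mul_one] at hk'
      have hk0 : 0 ≤ k := by exact_mod_cast hk' ▸ h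
      lift k to ℕ using hk0
      exact hq k (by rw [← hk']; simp)
  ext q
  rw [coeff_theta, HahnSeries.coeff_single_mul, one_mul]
  by_cases hq : ∃ n : ℕ, q = n
  · obtain ⟨n, rfl⟩ := hq
    rw [hnat]
    cases n with
    | zero => simp [coeff_powerSeriesRamify_of_neg]
    | succ n =>
      rw [Nat.cast_succ, add_sub_cancel_right, hnat, PowerSeries.coeff_derivative]
      push_cast
      ring
  · push Not at hq
    rw [hnot a q hq, hnot _ (q - 1), mul_zero]
    intro n hn
    exact hq (n + 1) (by push_cast; linarith)

/-- `f` as a polynomial over the field of Hahn series. -/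
noncomputable def overHahn (f : ℂ⟦X⟧[X]) : (HahnSeries ℚ ℂ)[X] :=
  f.map (Puiseux.subtype.comp (powerSeriesRamify 1))

theorem map_overK (f : ℂ⟦X⟧[X]) :
    (overK f).map (Puiseux.subtype.comp toPuiseux) = overHahn f := by
  rw [overK, Polynomial.map_map]; rfl

theorem map_toPuiseux_overK (f : ℂ⟦X⟧[X]) :
    (overK f).map toPuiseux = f.map (powerSeriesRamify 1) := by
  rw [overK, Polynomial.map_map]; rfl

theorem mapCoeff_theta_overHahn (f : ℂ⟦X⟧[X]) :
    mapCoeff theta (overHahn f) =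
      Polynomial.C (HahnSeries.single 1 1) * overHahn (partialX f) := by
  ext n : 1
  rw [coeff_mapCoeff, Polynomial.coeff_C_mul, overHahn, overHahn, Polynomial.coeff_map,
    Polynomial.coeff_map, coeff_partialX]
  exact theta_powerSeriesRamify_one _

/-- If `ν a ≤ 0`, then `a ^ n` has strictly smaller valuation than every other term of `f(a)`, as
the lower coefficients of `f` have positive valuation. -/
theorem ν_pos_of_mem_branches {f : ℂ⟦X⟧[X]}
    (hf : f.IsDistinguishedAt (IsLocalRing.maximalIdeal ℂ⟦X⟧)) {a : Puiseux}
    (ha : a ∈ branches f) : 0 < ν a := by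
  have hroot : (f.map (powerSeriesRamify 1)).eval a = 0 := by
    classical
    rw [branches, Multiset.mem_toFinset, map_toPuiseux_overK] at ha
    exact (Polynomial.mem_roots'.mp ha).2
  by_contra! hle
  obtain ⟨q, hq⟩ := WithTop.ne_top_iff_exists.mp (hle.trans_lt (WithTop.coe_lt_top 0)).ne
  have hq0 : q ≤ 0 := by rw [← hq] at hle; exact_mod_cast hle
  set v := HahnSeries.addVal ℚ ℂ
  set n := f.natDegree
  have hpow (k : ℕ) : v ((a : HahnSeries ℚ ℂ) ^ k) = ((k * q : ℚ) : WithTop ℚ) := by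
    rw [AddValuation.map_pow, HahnSeries.addVal_apply]
    change k • ν a = _
    rw [← hq, ← WithTop.coe_nsmul, nsmul_eq_mul]
  have hsum : (a : HahnSeries ℚ ℂ) ^ n = -∑ k ∈ Finset.range n,
      (powerSeriesRamify 1 (f.coeff k) : HahnSeries ℚ ℂ) * (a : HahnSeries ℚ ℂ) ^ k := by
    rw [Polynomial.eval_map, Polynomial.eval₂_eq_sum_range, Finset.sum_range_succ,
      hf.monic.coeff_natDegree, map_one, one_mul] at hroot
    have := congrArg Puiseux.subtype (eq_neg_of_add_eq_zero_right hroot)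
    simpa using this
  have hlt : v ((a : HahnSeries ℚ ℂ) ^ n) < v (-∑ k ∈ Finset.range n,
      (powerSeriesRamify 1 (f.coeff k) : HahnSeries ℚ ℂ) * (a : HahnSeries ℚ ℂ) ^ k) := by
    rw [AddValuation.map_neg]
    refine AddValuation.map_lt_sum _ (by rw [hpow]; exact WithTop.coe_ne_top) fun k hk => ?_
    rw [Finset.mem_range] at hk
    have hmem := hf.mem hk
    rw [PowerSeries.maximalIdeal_eq_span_X, Ideal.mem_span_singleton, PowerSeries.X_dvd_iff]
      at hmem
    rw [AddValuation.map_mul, hpow, hpow]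
    have h1 : ((n * q : ℚ) : WithTop ℚ) ≤ ((k * q : ℚ) : WithTop ℚ) := by
      have : (k : ℚ) ≤ n := by exact_mod_cast hk.le
      exact_mod_cast mul_le_mul_of_nonpos_right this hq0
    refine h1.trans_lt ?_
    conv_lhs => rw [← zero_add ((k * q : ℚ) : WithTop ℚ)]
    exact WithTop.add_lt_add_right WithTop.coe_ne_top (ν_powerSeriesRamify_pos 1 hmem)
  rw [← hsum] at hlt
  exact hlt.false

open Classical in
/-- The multiplicity of a Puiseux series as a root of `f`. -/
noncomputable def mult (f : ℂ⟦X⟧[X]) (b : Puiseux) : ℕ :=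
  ((overK f).map toPuiseux).roots.count b

theorem mult_ne_zero {f : ℂ⟦X⟧[X]} {b : Puiseux} (hb : b ∈ branches f) : mult f b ≠ 0 := by
  classical
  rw [branches, Multiset.mem_toFinset] at hb
  rw [mult, Multiset.count_ne_zero]
  exact hb

theorem overHahn_eq_prod {f : ℂ⟦X⟧[X]} (hf : f.Monic) : overHahn f =
    ∏ b ∈ branches f, (Polynomial.X - Polynomial.C (b : HahnSeries ℚ ℂ)) ^ mult f b := by
  classical
  have hm : ((overK f).map toPuiseux).Monic := (hf.map _).map _
  have h := (IsAlgClosed.splits ((overK f).map toPuiseux)).eq_prod_roots_of_monic hm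
  rw [Finset.prod_multiset_map_count] at h
  rw [← map_overK, ← Polynomial.map_map, h, Polynomial.map_prod]
  refine Finset.prod_congr (by rw [branches]) fun b _ => ?_
  simp [mult]

theorem branches_nonempty {f : ℂ⟦X⟧[X]} (hf : f.Monic) (hn : 0 < f.natDegree) :
    (branches f).Nonempty := by
  rw [Finset.nonempty_iff_ne_empty]
  intro h
  have h1 := congrArg Polynomial.natDegree (overHahn_eq_prod hf)
  rw [h, Finset.prod_empty, Polynomial.natDegree_one, overHahn, hf.natDegree_map] at h1
  omega

open Classical in
theorem map_eps (f : ℂ⟦X⟧[X]) (b : Puiseux) : (eps f b).map Puiseux.subtype =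
    Lagrange.nodal ((branches f).erase b) (fun b => (b : HahnSeries ℚ ℂ)) := by
  rw [eps, Polynomial.map_prod, Lagrange.nodal]
  simp

open Classical in
theorem map_sum_eps (f : ℂ⟦X⟧[X]) (c : Puiseux → Puiseux) :
    (∑ b ∈ branches f, Polynomial.C (c b) * eps f b).map Puiseux.subtype =
      ∑ b ∈ branches f, Polynomial.C (c b : HahnSeries ℚ ℂ) *
        Lagrange.nodal ((branches f).erase b) (fun b => (b : HahnSeries ℚ ℂ)) := by
  rw [Polynomial.map_sum]
  refine Finset.sum_congr rfl fun b _ => ?_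
  rw [Polynomial.map_mul, map_eps, Polynomial.map_C]
  rfl

theorem exists_eq_sum_eps {f : ℂ⟦X⟧[X]} {p : (LaurentSeries ℂ)[X]}
    (hp : p.degree < (branches f).card) : ∃ c : Puiseux → Puiseux,
      p.map toPuiseux = ∑ b ∈ branches f, Polynomial.C (c b) * eps f b := by
  classical
  have h := eq_sum_nodal_erase (s := branches f) (a := id) Function.injective_id.injOn
    (p := p.map toPuiseux) (by rwa [Polynomial.degree_map])
  exact ⟨_, h⟩

/-! ### Solutions over `ℂ((x))` and their filtration. -/

section Bridge

variable {f : ℂ⟦X⟧[X]}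

open Classical in
/-- The nodal equation equivalent to `w f = u f'_x + v f'_y`, in the field of Hahn series. -/
theorem nodal_equation_iff (hf : f.Monic) (u v w : (HahnSeries ℚ ℂ)[X]) :
    (Polynomial.C (HahnSeries.single 1 1) * w) *
        Lagrange.nodal (branches f) (fun b => (b : HahnSeries ℚ ℂ)) =
      -(u * ∑ b ∈ branches f, Polynomial.C (mult f b * theta b) *
        Lagrange.nodal ((branches f).erase b) (fun b => (b : HahnSeries ℚ ℂ))) +
      (Polynomial.C (HahnSeries.single 1 1) * v) * ∑ b ∈ branches f,
        Polynomial.C (mult f b : HahnSeries ℚ ℂ) *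
        Lagrange.nodal ((branches f).erase b) (fun b => (b : HahnSeries ℚ ℂ)) ↔
    w * overHahn f = u * overHahn (partialX f) + v * overHahn (Polynomial.derivative f) := by
  have hx0 : (Polynomial.C (HahnSeries.single 1 1) : (HahnSeries ℚ ℂ)[X]) ≠ 0 := by
    rw [Polynomial.C_ne_zero]
    exact HahnSeries.single_ne_zero one_ne_zero
  refine equation_iff_of_logDerivative (hf.map _).ne_zero Lagrange.nodal_ne_zero hx0 ?_ ?_ u v w
  · rw [← mapCoeff_theta_overHahn, overHahn_eq_prod hf]
    exact nodal_mul_mapCoeff_prod _ _ _ theta theta_mul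
  · have h1 : overHahn (Polynomial.derivative f) = Polynomial.derivative (overHahn f) :=
      (Polynomial.derivative_map _ _).symm
    rw [h1, overHahn_eq_prod hf]
    exact nodal_mul_derivative_prod _ _ _

theorem exists_solution_laurent
    (hf : f.IsDistinguishedAt (IsLocalRing.maximalIdeal ℂ⟦X⟧)) (hn : 0 < f.natDegree)
    {w : (LaurentSeries ℂ)[X]} (hw : w.degree < ((branches f).card - 1 : ℕ)) :
    ∃ u v : (LaurentSeries ℂ)[X], u.degree < ((branches f).card - 1 : ℕ) ∧
      v.degree < (branches f).card ∧
      w * overK f = u * overK (partialX f) + v * overK (Polynomial.derivative f) := by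
  classical
  set σ : LaurentSeries ℂ →+* HahnSeries ℚ ℂ := Puiseux.subtype.comp toPuiseux with hσ
  have hx : HahnSeries.single (1 : ℚ) (1 : ℂ) ≠ 0 := HahnSeries.single_ne_zero one_ne_zero
  obtain ⟨u, v, hu, hv, huv⟩ := exists_nodal_solution (s := branches f) (m := mult f)
    (a := fun b => (b : HahnSeries ℚ ℂ)) (branches_nonempty hf.monic hn)
    (fun b hb => mult_ne_zero hb) Subtype.val_injective.injOn
    (fun b hb => ν_pos_of_mem_branches hf hb)
    (w := Polynomial.C (HahnSeries.single 1 1) * w.map σ)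
    (by rwa [Polynomial.degree_C_mul hx, Polynomial.degree_map])
  -- The nodal equation involves `x v`, so its second unknown has to be divided by `x`.
  have hv' : v = Polynomial.C (HahnSeries.single 1 1) *
      (Polynomial.C (HahnSeries.single 1 1)⁻¹ * v) := by
    rw [← mul_assoc, ← Polynomial.C_mul, mul_inv_cancel₀ hx, Polynomial.C_1, one_mul]
  rw [hv', nodal_equation_iff hf.monic, ← map_overK, ← map_overK, ← map_overK, ← hσ] at huv
  -- Since `w`, `f` and the partial derivatives have coefficients in `ℂ((x))`, a `ℂ((x))`-linear
  -- retraction applied to the coefficients preserves the equation and the degree bounds.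
  obtain ⟨φ, hφ⟩ := exists_retraction σ
  refine ⟨mapCoeff φ u, mapCoeff φ (Polynomial.C (HahnSeries.single 1 1)⁻¹ * v),
    degree_mapCoeff_lt φ hu, degree_mapCoeff_lt φ ?_, ?_⟩
  · rwa [Polynomial.degree_C_mul (inv_ne_zero hx)]
  · have h := congrArg (mapCoeff φ) huv
    rw [map_add, mapCoeff_mul_map fun a k => (hφ a k).1, mapCoeff_mul_map fun a k => (hφ a k).1,
      mapCoeff_mul_map fun a k => (hφ a k).1] at h
    have hw' : mapCoeff φ (w.map σ) = w := by
      ext n : 1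
      rw [coeff_mapCoeff, Polynomial.coeff_map, (hφ 0 _).2]
    rwa [hw'] at h

theorem orderTop_x_mul (a : HahnSeries ℚ ℂ) :
    (HahnSeries.single 1 1 * a).orderTop = ((1 : ℚ) : WithTop ℚ) + a.orderTop := by
  rw [HahnSeries.orderTop_mul, HahnSeries.orderTop_single one_ne_zero]

/-- The bounds hold for every solution of these degrees, so the retraction that produced `u` and `v`
need not respect valuations. -/
theorem mem_fil_of_solution (hf : f.IsDistinguishedAt (IsLocalRing.maximalIdeal ℂ⟦X⟧))
    {r : ℚ} {u v w : (LaurentSeries ℂ)[X]} (hw : w ∈ filF f r)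
    (hu : u.degree < ((branches f).card - 1 : ℕ)) (hv : v.degree < (branches f).card)
    (h : w * overK f = u * overK (partialX f) + v * overK (Polynomial.derivative f)) :
    u ∈ filF f (r + 1) ∧ v ∈ filEgt f r := by
  classical
  have hu' : u.degree < (branches f).card := hu.trans_le (by exact_mod_cast Nat.sub_le _ _)
  obtain ⟨⟨-, cw, hcw, hwe⟩, -⟩ := hw
  obtain ⟨cu, hue⟩ := exists_eq_sum_eps hu'
  obtain ⟨cv, hve⟩ := exists_eq_sum_eps hv
  set x : HahnSeries ℚ ℂ := HahnSeries.single 1 1 with hx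
  have hH := congrArg (Polynomial.map (Puiseux.subtype.comp toPuiseux)) h
  rw [Polynomial.map_add, Polynomial.map_mul, Polynomial.map_mul, Polynomial.map_mul, map_overK,
    map_overK, map_overK, ← nodal_equation_iff hf.monic] at hH
  have hmap {p : (LaurentSeries ℂ)[X]} {c : Puiseux → Puiseux}
      (hp : p.map toPuiseux = ∑ b ∈ branches f, Polynomial.C (c b) * eps f b) :
      p.map (Puiseux.subtype.comp toPuiseux) = ∑ b ∈ branches f,
        Polynomial.C (c b : HahnSeries ℚ ℂ) *
        Lagrange.nodal ((branches f).erase b) (fun b => (b : HahnSeries ℚ ℂ)) := by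
    rw [← Polynomial.map_map, hp, map_sum_eps]
  have hxmap (c : Puiseux → Puiseux) : Polynomial.C x * (∑ b ∈ branches f,
        Polynomial.C (c b : HahnSeries ℚ ℂ) *
        Lagrange.nodal ((branches f).erase b) (fun b => (b : HahnSeries ℚ ℂ))) =
      ∑ b ∈ branches f, Polynomial.C (x * (c b : HahnSeries ℚ ℂ)) *
        Lagrange.nodal ((branches f).erase b) (fun b => (b : HahnSeries ℚ ℂ)) := by
    rw [Finset.mul_sum]
    exact Finset.sum_congr rfl fun b _ => by rw [Polynomial.C_mul, mul_assoc]
  rw [hmap hwe, hmap hue, hmap hve, hxmap, hxmap] at hH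
  obtain ⟨hvc, hwc⟩ := coefficients_of_nodal_equation
    (m := fun b => (mult f b : HahnSeries ℚ ℂ)) (b := fun b => theta b)
    (u := fun b => (cu b : HahnSeries ℚ ℂ)) (v := fun b => x * (cv b : HahnSeries ℚ ℂ))
    (w := fun b => x * (cw b : HahnSeries ℚ ℂ)) Subtype.val_injective.injOn
    (fun b hb => Nat.cast_ne_zero.mpr (mult_ne_zero hb)) hH
  -- The shift by one comes from the factor `x` in front of `w`.
  have hνu : ∀ b ∈ branches f, ((r + 1 : ℚ) : WithTop ℚ) ≤ ν (cu b) :=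
    le_orderTop_of_sum_mul_theta_div (fun b hb => mult_ne_zero hb) Subtype.val_injective.injOn
      (fun b hb => ν_pos_of_mem_branches hf hb)
      (sum_eq_zero_of_degree_lt (a := fun b : Puiseux => (b : HahnSeries ℚ ℂ)) (by
        rw [← hmap hue, Polynomial.degree_map]
        exact hu)) hwc
      (fun b hb => by
        rw [hx, orderTop_x_mul, add_comm r, WithTop.coe_add]
        exact add_le_add le_rfl (hcw b hb))
  refine ⟨⟨⟨Polynomial.mem_degreeLT.mpr hu', cu, hνu, hue⟩, Polynomial.mem_degreeLT.mpr hu⟩,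
    Polynomial.mem_degreeLT.mpr hv, cv, fun b hb => ?_, hve⟩
  -- From `x v_b = θ(b) u_b`: the strict inequality for `v` is due to `θ(b)` having positive order.
  have h1 := congrArg HahnSeries.orderTop (hvc b hb)
  rw [hx, orderTop_x_mul, HahnSeries.orderTop_mul] at h1
  have h2 : 0 < (theta (b : HahnSeries ℚ ℂ)).orderTop :=
    (ν_pos_of_mem_branches hf hb).trans_le (orderTop_le_orderTop_theta _)
  have h3 : ((r + 1 : ℚ) : WithTop ℚ) < ((1 : ℚ) : WithTop ℚ) + ν (cv b) := by
    have := WithTop.add_lt_add_of_lt_of_le (WithTop.coe_ne_top (a := r + 1)) h2 (hνu b hb)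
    rw [zero_add] at this
    exact this.trans_eq h1.symm
  rw [add_comm, WithTop.coe_add] at h3
  exact lt_of_add_lt_add_left h3

end Bridge

end PlaneBranches

theorem mainTheorem10 (f : ℂ⟦X⟧[X])
    (hf : f.IsDistinguishedAt (IsLocalRing.maximalIdeal ℂ⟦X⟧)) (hn : 2 ≤ f.natDegree)
    (r : ℚ) (hr : ∃ k : ℤ, r = (k : ℚ) / (PlaneBranches.lcmDegrees f : ℚ)) :
    ∀ w ∈ PlaneBranches.filF f r,
      ∃ u ∈ PlaneBranches.filF f (r + 1), ∃ v ∈ PlaneBranches.filEgt f r,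
        w * PlaneBranches.overK f =
          u * PlaneBranches.overK (PlaneBranches.partialX f) +
            v * PlaneBranches.overK (Polynomial.derivative f) := by
  intro w hw
  obtain ⟨u, v, hu, hv, h⟩ := PlaneBranches.exists_solution_laurent hf (by omega)
    (Polynomial.mem_degreeLT.mp hw.2)
  obtain ⟨hu', hv'⟩ := PlaneBranches.mem_fil_of_solution hf hw hu hv h
  exact ⟨u, hu', v, hv', h⟩
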